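/- Let $n \ge 8$ be an integer. All rings and algebras are commutative, associative, with $1$; an étale $\mathbb{Q}$-algebra is a finite product of number fields, and an order in an étale $\mathbb{Q}$-algebra $K$ is a subring of $K$ that is finitely generated as a $\mathbb{Z}$-module and spans $K$ over $\mathbb{Q}$. Then there exist a prime $p$ and an $\mathbb{F}_p$-algebra of rank $n$ (that is, of $\mathbb{F}_p$-dimension $n$) that is not isomorphic to $A/pA$ for any order $A$ in an étale $\mathbb{Q}$-algebra. Explicitly, for every prime $p$, the algebra $$A_0 := \frac{\mathbb{F}_p[a,b,c,d]}{(a^2,\,ab,\,b^2,\,c^2,\,cd,\,d^2,\,ad-bc)} \times \mathbb{F}_p \times \cdots \times \mathbb{F}_p$$ with $n-8$ factors $\mathbb{F}_p$ has rank $n$ over $\mathbb{F}_p$ and is not isomorphic to $A/pA$ for any order $A$ in an étale $\mathbb{Q}$-algebra. -/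

import Mathlib

universe u v

/-- An order in a finite-dimensional commutative `ℚ`-algebra `K`: a subring of `K` that is finitely
generated as a `ℤ`-module and spans `K` over `ℚ`. -/
structure IsOrderIn (K : Type*) [CommRing K] [Algebra ℚ K] (A : Subring K) : Prop where
  finite : Module.Finite ℤ A
  span_eq_top : Submodule.span ℚ (A : Set K) = ⊤

/-- `R` is isomorphic to `A / pA` for some order `A` in an étale `ℚ`-algebra `K`.
For `𝔽_p`-algebras, a ring isomorphism is the same thing as an `𝔽_p`-algebra isomorphism, because
a ring carries at most one structure of `𝔽_p`-algebra and every ring homomorphism respects it. -/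
def IsModPOfEtaleOrder (p : ℕ) (R : Type v) [CommRing R] : Prop :=
  ∃ (K : Type u) (_ : CommRing K) (_ : Algebra ℚ K) (A : Subring K),
    Algebra.Etale ℚ K ∧ IsOrderIn K A ∧
      Nonempty (R ≃+* (A ⧸ Ideal.span {(p : A)}))

/-- The ideal `(a², ab, b², c², cd, d², ad - bc)` of `k[a, b, c, d]`. -/
noncomputable def rankEightIdeal (k : Type*) [CommRing k] : Ideal (MvPolynomial (Fin 4) k) :=
  let a : MvPolynomial (Fin 4) k := MvPolynomial.X 0
  let b : MvPolynomial (Fin 4) k := MvPolynomial.X 1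
  let c : MvPolynomial (Fin 4) k := MvPolynomial.X 2
  let d : MvPolynomial (Fin 4) k := MvPolynomial.X 3
  Ideal.span {a ^ 2, a * b, b ^ 2, c ^ 2, c * d, d ^ 2, a * d - b * c}

/-- `k[a, b, c, d] / (a², ab, b², c², cd, d², ad - bc) × k × ⋯ × k` with `m` factors `k`. -/
abbrev RankEightTimesSplit (k : Type*) [CommRing k] (m : ℕ) : Type _ :=
  (MvPolynomial (Fin 4) k ⧸ rankEightIdeal k) × (Fin m → k)

/-! The local factor has no deformations that would make it reduced. Let `C` be `p`-torsion-free
with `C / pC` the local algebra, let `m = (a, b, c, d)` for lifts of the variables, and let `J =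
(ac, ad, bd)`. Suppose the seven quadrics lie in `pJ + (pⁿ)`. Then `mJ ⊆ (pⁿ)`, and the linear
syzygies of the quadrics constrain their `pⁿ`-terms modulo `p`. By `exists_translation` these terms
are, modulo `J`, the effect of moving `a, b, c, d`. Translating by multiples of `pⁿ` therefore
raises `n` by one (`QuadricsVanish.exists_succ`), so for every `n` some lift of `a` has cube in
`(pⁿ)`. In an order `A` of an étale algebra this is impossible: the integral closure is finite, so a
fixed nonzero integer carries it into `A`, and an element with cube in `(p^N)`, `N` large, lies in
`pA` (`IsOrderIn.exists_dvd_of_cube_eq`). But `a ≠ 0` modulo `p`. Inverting a lift of the idempotent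
`(1, 0)` removes the split factors. -/

namespace RankEight

open MvPolynomial

/-! ### The local algebra: monomial basis and tangent directions -/

section Algebra

variable (k : Type*) [CommRing k]

/-- The local algebra `k[a, b, c, d] / (a², ab, b², c², cd, d², ad - bc)`. -/
abbrev LocalAlgebra : Type _ := MvPolynomial (Fin 4) k ⧸ rankEightIdeal k

/-- The images of the variables in the local algebra. -/
noncomputable def gen (i : Fin 4) : LocalAlgebra k := Ideal.Quotient.mk _ (X i)

variable {k}

theorem mk_eq_zero_of_mem {f : MvPolynomial (Fin 4) k}
    (hf : f ∈ ({X 0 ^ 2, X 0 * X 1, X 1 ^ 2, X 2 ^ 2, X 2 * X 3, X 3 ^ 2,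
      X 0 * X 3 - X 1 * X 2} : Set (MvPolynomial (Fin 4) k))) :
    Ideal.Quotient.mk (rankEightIdeal k) f = 0 :=
  Ideal.Quotient.eq_zero_iff_mem.mpr (Ideal.subset_span hf)

theorem gen_zero_sq : gen k 0 ^ 2 = 0 := mk_eq_zero_of_mem (f := X 0 ^ 2) (by simp)

theorem gen_zero_mul_gen_one : gen k 0 * gen k 1 = 0 :=
  mk_eq_zero_of_mem (f := X 0 * X 1) (by simp)

theorem gen_one_sq : gen k 1 ^ 2 = 0 := mk_eq_zero_of_mem (f := X 1 ^ 2) (by simp)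

theorem gen_two_sq : gen k 2 ^ 2 = 0 := mk_eq_zero_of_mem (f := X 2 ^ 2) (by simp)

theorem gen_two_mul_gen_three : gen k 2 * gen k 3 = 0 :=
  mk_eq_zero_of_mem (f := X 2 * X 3) (by simp)

theorem gen_three_sq : gen k 3 ^ 2 = 0 := mk_eq_zero_of_mem (f := X 3 ^ 2) (by simp)

theorem gen_det : gen k 0 * gen k 3 - gen k 1 * gen k 2 = 0 :=
  mk_eq_zero_of_mem (f := X 0 * X 3 - X 1 * X 2) (by simp)

/-- The monomials `1, a, b, c, d, ac, ad, bd`. -/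
noncomputable def monomialFamily : Fin 8 → LocalAlgebra k :=
  ![1, gen k 0, gen k 1, gen k 2, gen k 3, gen k 0 * gen k 2, gen k 0 * gen k 3,
    gen k 1 * gen k 3]

/-- The linear combination of the monomials `1, a, b, c, d, ac, ad, bd` with given coefficients. -/
noncomputable def comb (t x y z w u v s : k) : LocalAlgebra k :=
  algebraMap k _ t + algebraMap k _ x * gen k 0 + algebraMap k _ y * gen k 1
    + algebraMap k _ z * gen k 2 + algebraMap k _ w * gen k 3
    + algebraMap k _ u * (gen k 0 * gen k 2) + algebraMap k _ v * (gen k 0 * gen k 3)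
    + algebraMap k _ s * (gen k 1 * gen k 3)

theorem comb_add (t x y z w u v s t' x' y' z' w' u' v' s' : k) :
    comb t x y z w u v s + comb t' x' y' z' w' u' v' s' =
      comb (t + t') (x + x') (y + y') (z + z') (w + w') (u + u') (v + v') (s + s') := by
  simp only [comb, map_add]; ring

theorem comb_sub (t x y z w u v s t' x' y' z' w' u' v' s' : k) :
    comb t x y z w u v s - comb t' x' y' z' w' u' v' s' =
      comb (t - t') (x - x') (y - y') (z - z') (w - w') (u - u') (v - v') (s - s') := by
  simp only [comb, map_sub]; ring

theorem gen_zero_mul_comb (t x y z w u v s : k) :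
    gen k 0 * comb t x y z w u v s = comb 0 t 0 0 0 z w 0 := by
  simp only [comb, map_zero]
  linear_combination (algebraMap k (LocalAlgebra k) x + algebraMap k (LocalAlgebra k) u * gen k 2
    + algebraMap k (LocalAlgebra k) v * gen k 3) * gen_zero_sq (k := k)
    + (algebraMap k (LocalAlgebra k) y + algebraMap k (LocalAlgebra k) s * gen k 3)
      * gen_zero_mul_gen_one (k := k)

theorem gen_one_mul_comb (t x y z w u v s : k) :
    gen k 1 * comb t x y z w u v s = comb 0 0 t 0 0 0 z w := by
  simp only [comb, map_zero]
  linear_combination (algebraMap k (LocalAlgebra k) x + algebraMap k (LocalAlgebra k) u * gen k 2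
    + algebraMap k (LocalAlgebra k) v * gen k 3) * gen_zero_mul_gen_one (k := k)
    + (algebraMap k (LocalAlgebra k) y + algebraMap k (LocalAlgebra k) s * gen k 3)
      * gen_one_sq (k := k) - algebraMap k (LocalAlgebra k) z * gen_det (k := k)

theorem gen_two_mul_comb (t x y z w u v s : k) :
    gen k 2 * comb t x y z w u v s = comb 0 0 0 t 0 x y 0 := by
  simp only [comb, map_zero]
  linear_combination (algebraMap k (LocalAlgebra k) z + algebraMap k (LocalAlgebra k) u * gen k 0)
      * gen_two_sq (k := k)
    + (algebraMap k (LocalAlgebra k) w + algebraMap k (LocalAlgebra k) v * gen k 0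
      + algebraMap k (LocalAlgebra k) s * gen k 1) * gen_two_mul_gen_three (k := k)
    - algebraMap k (LocalAlgebra k) y * gen_det (k := k)

theorem gen_three_mul_comb (t x y z w u v s : k) :
    gen k 3 * comb t x y z w u v s = comb 0 0 0 0 t 0 x y := by
  simp only [comb, map_zero]
  linear_combination (algebraMap k (LocalAlgebra k) z + algebraMap k (LocalAlgebra k) u * gen k 0)
      * gen_two_mul_gen_three (k := k)
    + (algebraMap k (LocalAlgebra k) w + algebraMap k (LocalAlgebra k) v * gen k 0
      + algebraMap k (LocalAlgebra k) s * gen k 1) * gen_three_sq (k := k)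

/-- The combinations contain the constants and, by the four multiplication rules above, are stable
under each variable. -/
theorem exists_eq_comb (r : LocalAlgebra k) :
    ∃ t x y z w u v s : k, r = comb t x y z w u v s := by
  obtain ⟨f, rfl⟩ := Ideal.Quotient.mk_surjective r
  induction f using MvPolynomial.induction_on with
  | C t =>
    refine ⟨t, 0, 0, 0, 0, 0, 0, 0, ?_⟩
    simp only [comb, map_zero, zero_mul, add_zero]
    rfl
  | add f g hf hg =>
    obtain ⟨t, x, y, z, w, u, v, s, h⟩ := hf
    obtain ⟨t', x', y', z', w', u', v', s', h'⟩ := hg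
    exact ⟨_, _, _, _, _, _, _, _, by rw [map_add, h, h', comb_add]⟩
  | mul_X f i hf =>
    obtain ⟨t, x, y, z, w, u, v, s, h⟩ := hf
    have key : Ideal.Quotient.mk (rankEightIdeal k) (f * X i) =
        gen k i * comb t x y z w u v s := by rw [map_mul, h, mul_comm]; rfl
    rw [key]
    fin_cases i
    · exact ⟨_, _, _, _, _, _, _, _, gen_zero_mul_comb ..⟩
    · exact ⟨_, _, _, _, _, _, _, _, gen_one_mul_comb ..⟩
    · exact ⟨_, _, _, _, _, _, _, _, gen_two_mul_comb ..⟩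
    · exact ⟨_, _, _, _, _, _, _, _, gen_three_mul_comb ..⟩

theorem exists_ringHom_localAlgebra {T : Type*} [CommRing T] (f : k →+* T) (g : Fin 4 → T)
    (h₁ : g 0 * g 0 = 0) (h₂ : g 0 * g 1 = 0) (h₃ : g 1 * g 1 = 0) (h₄ : g 2 * g 2 = 0)
    (h₅ : g 2 * g 3 = 0) (h₆ : g 3 * g 3 = 0) (h₇ : g 0 * g 3 = g 1 * g 2) :
    ∃ F : LocalAlgebra k →+* T, (∀ t, F (algebraMap k _ t) = f t) ∧ ∀ i, F (gen k i) = g i := by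
  have hker : rankEightIdeal k ≤ RingHom.ker (eval₂Hom f g) := by
    refine Ideal.span_le.mpr ?_
    rintro q (rfl | rfl | rfl | rfl | rfl | rfl | rfl) <;>
      simp [RingHom.mem_ker, pow_two, h₁, h₂, h₃, h₄, h₅, h₆, h₇]
  refine ⟨Ideal.Quotient.lift _ (eval₂Hom f g) fun _ hq => RingHom.mem_ker.mp (hker hq),
    fun t => ?_, fun i => ?_⟩
  · have : algebraMap k (LocalAlgebra k) t = Ideal.Quotient.mk _ (C t) := rfl
    rw [this, Ideal.Quotient.lift_mk, coe_eval₂Hom, eval₂_C]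
  · rw [gen, Ideal.Quotient.lift_mk, coe_eval₂Hom, eval₂_X]

theorem map_comb {T : Type*} [CommRing T] {f : k →+* T} {g : Fin 4 → T} (F : LocalAlgebra k →+* T)
    (hf : ∀ t, F (algebraMap k _ t) = f t) (hg : ∀ i, F (gen k i) = g i) (t x y z w u v s : k) :
    F (comb t x y z w u v s) = f t + f x * g 0 + f y * g 1 + f z * g 2 + f w * g 3
      + f u * (g 0 * g 2) + f v * (g 0 * g 3) + f s * (g 1 * g 3) := by
  simp only [comb, map_add, map_mul, hf, hg]

/-- Applied twice to adjoin `δ` and `ε`; only `e² = 0` and the independence of `1, e` are needed. -/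
theorem exists_dualNumber (P : Type u) [CommRing P] :
    ∃ (T : Type u) (_ : CommRing T) (f : P →+* T) (e : T), e * e = 0 ∧
      ∀ x y, f x + f y * e = 0 → x = 0 ∧ y = 0 := by
  refine ⟨DualNumber P, inferInstance, TrivSqZeroExt.inlHom P P, DualNumber.eps,
    DualNumber.eps_mul_eps, fun x y h => ⟨?_, ?_⟩⟩
  · simpa using congrArg TrivSqZeroExt.fst h
  · simpa using congrArg TrivSqZeroExt.snd h

/-- Linear independence of the monomials, read off in `k[T][δ, ε] / (δ², ε²)` through
`a ↦ ε`, `b ↦ εT`, `c ↦ δ`, `d ↦ δT`. -/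
theorem comb_eq_zero {t x y z w u v s : k} (h : comb t x y z w u v s = 0) :
    t = 0 ∧ x = 0 ∧ y = 0 ∧ z = 0 ∧ w = 0 ∧ u = 0 ∧ v = 0 ∧ s = 0 := by
  obtain ⟨T₁, _, f₁, δ, hδ, h₁⟩ := exists_dualNumber (Polynomial k)
  obtain ⟨T₂, _, f₂, ε, hε, h₂⟩ := exists_dualNumber T₁
  have hδ' : f₂ δ * f₂ δ = 0 := by rw [← map_mul, hδ, map_zero]
  let τ : T₂ := f₂ (f₁ Polynomial.X)
  obtain ⟨F, hf, hg⟩ := exists_ringHom_localAlgebra ((f₂.comp f₁).comp Polynomial.C)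
    ![ε, ε * τ, f₂ δ, f₂ δ * τ] hε (by simp; linear_combination τ * hε)
    (by simp; linear_combination τ ^ 2 * hε) hδ' (by simp; linear_combination τ * hδ')
    (by simp; linear_combination τ ^ 2 * hδ') (by simp; ring)
  have h' := map_comb F hf hg t x y z w u v s
  rw [h, map_zero] at h'
  simp only [RingHom.comp_apply, Matrix.cons_val_zero, Matrix.cons_val_one, Matrix.cons_val] at h'
  obtain ⟨a₁, a₂⟩ := h₂
    (f₁ (Polynomial.C t) + f₁ (Polynomial.C z + Polynomial.C w * Polynomial.X) * δ)
    (f₁ (Polynomial.C x + Polynomial.C y * Polynomial.X) + f₁ (Polynomial.C u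
      + Polynomial.C v * Polynomial.X + Polynomial.C s * Polynomial.X ^ 2) * δ) (by
      simp only [map_add, map_mul, map_pow]
      linear_combination -h')
  obtain ⟨b₁, b₂⟩ := h₁ _ _ a₁
  obtain ⟨b₃, b₄⟩ := h₁ _ _ a₂
  have e₂ (n : ℕ) := congrArg (fun q => q.coeff n) b₂
  have e₃ (n : ℕ) := congrArg (fun q => q.coeff n) b₃
  have e₄ (n : ℕ) := congrArg (fun q => q.coeff n) b₄
  exact ⟨by simpa using b₁, by simpa using e₃ 0, by simpa using e₃ 1, by simpa using e₂ 0,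
    by simpa using e₂ 1, by simpa using e₄ 0, by simpa [Polynomial.coeff_X_pow] using e₄ 1,
    by simpa [Polynomial.coeff_X, Polynomial.coeff_C] using e₄ 2⟩

theorem comb_inj {t x y z w u v s t' x' y' z' w' u' v' s' : k}
    (h : comb t x y z w u v s = comb t' x' y' z' w' u' v' s') :
    t = t' ∧ x = x' ∧ y = y' ∧ z = z' ∧ w = w' ∧ u = u' ∧ v = v' ∧ s = s' := by
  rw [← sub_eq_zero, comb_sub] at h
  simpa only [sub_eq_zero] using comb_eq_zero h

theorem gen_zero_ne_zero [Nontrivial k] : gen k 0 ≠ 0 := by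
  intro h
  have : comb (k := k) 0 1 0 0 0 0 0 0 = 0 := by simp [comb, h]
  exact one_ne_zero (comb_eq_zero this).2.1

theorem finrank_localAlgebra [Nontrivial k] : Module.finrank k (LocalAlgebra k) = 8 := by
  have hsum (g : Fin 8 → k) : ∑ i, g i • monomialFamily i =
      comb (g 0) (g 1) (g 2) (g 3) (g 4) (g 5) (g 6) (g 7) := by
    have hsmul (t : k) (r : LocalAlgebra k) : t • r = algebraMap k _ t * r := Algebra.smul_def t r
    simp [Fin.sum_univ_eight, monomialFamily, comb, hsmul]
  have hli : LinearIndependent k (monomialFamily (k := k)) := by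
    rw [Fintype.linearIndependent_iff]
    intro g hg i
    rw [hsum] at hg
    obtain ⟨h0, h1, h2, h3, h4, h5, h6, h7⟩ := comb_eq_zero hg
    fin_cases i <;> assumption
  have hspan : ⊤ ≤ Submodule.span k (Set.range (monomialFamily (k := k))) := by
    intro r _
    obtain ⟨t, x, y, z, w, u, v, s, rfl⟩ := exists_eq_comb r
    rw [Submodule.mem_span_range_iff_exists_fun]
    exact ⟨![t, x, y, z, w, u, v, s], hsum _⟩
  simpa using Module.finrank_eq_card_basis (Module.Basis.mk hli hspan)

theorem finrank_rankEightTimesSplit (k : Type*) [Field k] (m : ℕ) :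
    Module.finrank k (RankEightTimesSplit k m) = 8 + m := by
  have : Module.Finite k (LocalAlgebra k) :=
    Module.finite_of_finrank_pos (by rw [finrank_localAlgebra]; norm_num)
  rw [Module.finrank_prod, finrank_localAlgebra, Module.finrank_fin_fun]

/-- The ideal `(ac, ad, bd)` built from elements `a, b, c, d` of a ring. -/
def topIdeal {C : Type*} [CommRing C] (a b c d : C) : Ideal C := Ideal.span {a * c, a * d, b * d}

theorem mem_topIdeal {C : Type*} [CommRing C] {a b c d x : C} :
    x ∈ topIdeal a b c d ↔ ∃ u v s, x = u * (a * c) + v * (a * d) + s * (b * d) := by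
  simp only [topIdeal, Ideal.mem_span_insert, Ideal.mem_span_singleton']
  constructor
  · rintro ⟨u, _, ⟨v, _, ⟨s, rfl⟩, rfl⟩, rfl⟩
    exact ⟨u, v, s, by ring⟩
  · rintro ⟨u, v, s, rfl⟩
    exact ⟨u, _, ⟨v, _, ⟨s, rfl⟩, rfl⟩, by ring⟩

set_option linter.unusedSimpArgs false in
/-- A linear map from the quadrics `a², ab, b², c², cd, d², ad - bc` to the local algebra that
respects the linear syzygies is, modulo `(ac, ad, bd)`, the derivative along a translation. -/
theorem exists_translation {r₁ r₂ r₃ r₄ r₅ r₆ r₇ : LocalAlgebra k}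
    (h₁ : gen k 1 * r₁ = gen k 0 * r₂) (h₂ : gen k 0 * r₃ = gen k 1 * r₂)
    (h₃ : gen k 0 * r₇ = gen k 3 * r₁ - gen k 2 * r₂)
    (h₄ : gen k 1 * r₇ = gen k 3 * r₂ - gen k 2 * r₃)
    (h₅ : gen k 3 * r₄ = gen k 2 * r₅) (h₆ : gen k 2 * r₆ = gen k 3 * r₅)
    (h₇ : gen k 2 * r₇ = gen k 0 * r₅ - gen k 1 * r₄)
    (h₈ : gen k 3 * r₇ = gen k 0 * r₆ - gen k 1 * r₅) :
    ∃ e₀ e₁ e₂ e₃ : LocalAlgebra k,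
      r₁ - 2 * e₀ * gen k 0 ∈ topIdeal (gen k 0) (gen k 1) (gen k 2) (gen k 3) ∧
      r₂ - (e₀ * gen k 1 + e₁ * gen k 0) ∈ topIdeal (gen k 0) (gen k 1) (gen k 2) (gen k 3) ∧
      r₃ - 2 * e₁ * gen k 1 ∈ topIdeal (gen k 0) (gen k 1) (gen k 2) (gen k 3) ∧
      r₄ - 2 * e₂ * gen k 2 ∈ topIdeal (gen k 0) (gen k 1) (gen k 2) (gen k 3) ∧
      r₅ - (e₂ * gen k 3 + e₃ * gen k 2) ∈ topIdeal (gen k 0) (gen k 1) (gen k 2) (gen k 3) ∧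
      r₆ - 2 * e₃ * gen k 3 ∈ topIdeal (gen k 0) (gen k 1) (gen k 2) (gen k 3) ∧
      r₇ - (e₀ * gen k 3 + e₃ * gen k 0 - e₁ * gen k 2 - e₂ * gen k 1) ∈
        topIdeal (gen k 0) (gen k 1) (gen k 2) (gen k 3) := by
  obtain ⟨t₁, x₁, y₁, z₁, w₁, u₁, v₁, s₁, rfl⟩ := exists_eq_comb r₁
  obtain ⟨t₂, x₂, y₂, z₂, w₂, u₂, v₂, s₂, rfl⟩ := exists_eq_comb r₂
  obtain ⟨t₃, x₃, y₃, z₃, w₃, u₃, v₃, s₃, rfl⟩ := exists_eq_comb r₃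
  obtain ⟨t₄, x₄, y₄, z₄, w₄, u₄, v₄, s₄, rfl⟩ := exists_eq_comb r₄
  obtain ⟨t₅, x₅, y₅, z₅, w₅, u₅, v₅, s₅, rfl⟩ := exists_eq_comb r₅
  obtain ⟨t₆, x₆, y₆, z₆, w₆, u₆, v₆, s₆, rfl⟩ := exists_eq_comb r₆
  obtain ⟨t₇, x₇, y₇, z₇, w₇, u₇, v₇, s₇, rfl⟩ := exists_eq_comb r₇
  simp only [gen_zero_mul_comb, gen_one_mul_comb, gen_two_mul_comb, gen_three_mul_comb,
    comb_sub] at h₁ h₂ h₃ h₄ h₅ h₆ h₇ h₈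
  replace h₁ := comb_inj h₁
  replace h₂ := comb_inj h₂
  replace h₃ := comb_inj h₃
  replace h₄ := comb_inj h₄
  replace h₅ := comb_inj h₅
  replace h₆ := comb_inj h₆
  replace h₇ := comb_inj h₇
  replace h₈ := comb_inj h₈
  let φ := algebraMap k (LocalAlgebra k)
  -- The last three coefficients are absorbed by `(ac, ad, bd)`, so only constant and linear parts
  -- have to match.
  have key {r e : LocalAlgebra k} {t x y z w u v s : k} (hr : r = comb t x y z w u v s)
      (he : e = comb t x y z w 0 0 0) :
      r - e ∈ topIdeal (gen k 0) (gen k 1) (gen k 2) (gen k 3) :=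
    mem_topIdeal.mpr ⟨φ u, φ v, φ s, by rw [hr, he]; simp only [comb, map_zero, φ]; ring⟩
  -- The translation is read off from the linear parts of `r₂` and `r₅`, since `ab` varies by `e₀b +
  -- e₁a` and `cd` by `e₂d + e₃c`. This avoids dividing by 2.
  refine ⟨φ y₂, φ x₂, φ w₅, φ z₅, key rfl ?_, key rfl ?_, key rfl ?_, key rfl ?_, key rfl ?_,
    key rfl ?_, key rfl ?_⟩
  · rw [show t₁ = 0 by grind, show x₁ = 2 * y₂ by grind, show y₁ = 0 by grind,
      show z₁ = 0 by grind, show w₁ = 0 by grind]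
    simp only [comb, map_zero, map_neg, map_mul, map_ofNat, φ]; ring
  · rw [show t₂ = 0 by grind, show z₂ = 0 by grind, show w₂ = 0 by grind]
    simp only [comb, map_zero, map_neg, map_mul, map_ofNat, φ]; ring
  · rw [show t₃ = 0 by grind, show x₃ = 0 by grind, show y₃ = 2 * x₂ by grind,
      show z₃ = 0 by grind, show w₃ = 0 by grind]
    simp only [comb, map_zero, map_neg, map_mul, map_ofNat, φ]; ring
  · rw [show t₄ = 0 by grind, show x₄ = 0 by grind, show y₄ = 0 by grind,
      show z₄ = 2 * w₅ by grind, show w₄ = 0 by grind]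
    simp only [comb, map_zero, map_neg, map_mul, map_ofNat, φ]; ring
  · rw [show t₅ = 0 by grind, show x₅ = 0 by grind, show y₅ = 0 by grind]
    simp only [comb, map_zero, map_neg, map_mul, map_ofNat, φ]; ring
  · rw [show t₆ = 0 by grind, show x₆ = 0 by grind, show y₆ = 0 by grind,
      show z₆ = 0 by grind, show w₆ = 2 * z₅ by grind]
    simp only [comb, map_zero, map_neg, map_mul, map_ofNat, φ]; ring
  · rw [show t₇ = 0 by grind, show x₇ = z₅ by grind, show y₇ = -w₅ by grind,
      show z₇ = -x₂ by grind, show w₇ = y₂ by grind]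
    simp only [comb, map_zero, map_neg, map_mul, map_ofNat, φ]; ring

end Algebra

/-! ### Lifting approximate solutions of the quadrics `p`-adically -/

section Lifting

variable {C : Type*} [CommRing C]

/-- The ideal `p · (ac, ad, bd) + (pⁿ)`. -/
def errorIdeal (p : C) (n : ℕ) (a b c d : C) : Ideal C :=
  Ideal.span {p} * topIdeal a b c d ⊔ Ideal.span {p ^ n}

theorem mem_errorIdeal {p : C} {n : ℕ} {a b c d x : C} :
    x ∈ errorIdeal p n a b c d ↔ ∃ s ∈ topIdeal a b c d, ∃ r, x = p * s + p ^ n * r := by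
  simp only [errorIdeal, Submodule.mem_sup, Ideal.mem_span_singleton_mul,
    Ideal.mem_span_singleton']
  constructor
  · rintro ⟨_, ⟨s, hs, rfl⟩, _, ⟨r, rfl⟩, rfl⟩
    exact ⟨s, hs, r, by ring⟩
  · rintro ⟨s, hs, r, rfl⟩
    exact ⟨_, ⟨s, hs, rfl⟩, _, ⟨r, rfl⟩, by ring⟩

/-- The seven quadrics that define the local algebra vanish at `(a, b, c, d)` up to
`p · (ac, ad, bd) + (pⁿ)`. -/
structure QuadricsVanish (p : C) (n : ℕ) (a b c d : C) : Prop where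
  sq_a : a ^ 2 ∈ errorIdeal p n a b c d
  ab : a * b ∈ errorIdeal p n a b c d
  sq_b : b ^ 2 ∈ errorIdeal p n a b c d
  sq_c : c ^ 2 ∈ errorIdeal p n a b c d
  cd : c * d ∈ errorIdeal p n a b c d
  sq_d : d ^ 2 ∈ errorIdeal p n a b c d
  det : a * d - b * c ∈ errorIdeal p n a b c d

variable {p : C} {n : ℕ} {a b c d : C}

/-- If the quadrics vanish up to order `n`, then so do the products of the ideal `(ac, ad, bd)` with
`(a, b, c, d)`. -/
theorem QuadricsVanish.mul_topIdeal_le (h : QuadricsVanish p n a b c d) :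
    Ideal.span {a, b, c, d} * topIdeal a b c d ≤ Ideal.span {p ^ n} := by
  set m : Ideal C := Ideal.span {a, b, c, d} with hm
  set J := topIdeal a b c d with hJ
  have ha : a ∈ m := Ideal.subset_span (by simp)
  have hb : b ∈ m := Ideal.subset_span (by simp)
  have hc : c ∈ m := Ideal.subset_span (by simp)
  have hd : d ∈ m := Ideal.subset_span (by simp)
  have hmul {x q : C} (hx : x ∈ m) (hq : q ∈ errorIdeal p n a b c d) :
      x * q ∈ Ideal.span {p} * (m * J) ⊔ Ideal.span {p ^ n} := by
    obtain ⟨s, hs, r, rfl⟩ := mem_errorIdeal.mp hq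
    rw [show x * (p * s + p ^ n * r) = p * (x * s) + x * r * p ^ n by ring]
    exact Submodule.add_mem_sup
      (Ideal.mul_mem_mul (Ideal.mem_span_singleton_self p) (Ideal.mul_mem_mul hx hs))
      (Ideal.mul_mem_left _ _ (Ideal.mem_span_singleton_self _))
  -- Each product of a variable with `ac`, `ad` or `bd` is a variable times a quadric in `a, b`
  -- alone or in `c, d` alone.
  have hle : m * J ≤ Ideal.span {p} * (m * J) ⊔ Ideal.span {p ^ n} := by
    conv_lhs => rw [hm, hJ, topIdeal, Ideal.span_mul_span']
    rw [Ideal.span_le]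
    rintro _ ⟨x, hx, y, hy, rfl⟩
    simp only [SetLike.mem_coe]
    simp only [Set.mem_insert_iff, Set.mem_singleton_iff] at hx hy
    rcases hx with rfl | rfl | rfl | rfl <;> rcases hy with rfl | rfl | rfl
    · convert hmul hc h.sq_a using 1; ring
    · convert hmul hd h.sq_a using 1; ring
    · convert hmul hd h.ab using 1; ring
    · convert hmul hc h.ab using 1; ring
    · convert hmul hd h.ab using 1; ring
    · convert hmul hd h.sq_b using 1; ring
    · convert hmul ha h.sq_c using 1; ring
    · convert hmul ha h.cd using 1; ring
    · convert hmul hb h.cd using 1; ring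
    · convert hmul ha h.cd using 1; ring
    · convert hmul ha h.sq_d using 1; ring
    · convert hmul hb h.sq_d using 1; ring
  -- Substituting the inclusion into itself gains a factor `p` each time.
  have hpow (j : ℕ) : m * J ≤ Ideal.span {p ^ j} ⊔ Ideal.span {p ^ n} := by
    induction j with
    | zero => simp
    | succ j ih =>
      refine hle.trans (sup_le ?_ le_sup_right)
      refine (Ideal.mul_mono_right ih).trans ?_
      rw [Ideal.mul_sup, Ideal.span_singleton_mul_span_singleton, ← pow_succ']
      exact sup_le_sup_left Ideal.mul_le_right _
  simpa using hpow n

theorem QuadricsVanish.mul_mem (h : QuadricsVanish p n a b c d) {x s : C}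
    (hx : x ∈ Ideal.span {a, b, c, d}) (hs : s ∈ topIdeal a b c d) : ∃ y, x * s = p ^ n * y := by
  obtain ⟨y, hy⟩ := Ideal.mem_span_singleton'.mp (h.mul_topIdeal_le (Ideal.mul_mem_mul hx hs))
  exact ⟨y, by rw [← hy, mul_comm]⟩

/-- Multiply `a² ∈ pJ + (pⁿ)` by `a` and use `mJ ⊆ (pⁿ)`. -/
theorem QuadricsVanish.exists_cube_eq (h : QuadricsVanish p n a b c d) :
    ∃ y, a ^ 3 = p ^ n * y := by
  obtain ⟨s, hs, r, hr⟩ := mem_errorIdeal.mp h.sq_a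
  obtain ⟨y, hy⟩ := h.mul_mem (Ideal.subset_span (by simp) : a ∈ _) hs
  exact ⟨p * y + a * r, by linear_combination a * hr + p * hy⟩

/-- Translation alters `J` only modulo `pⁿ`, hence `pJ` only modulo `pⁿ⁺¹`. -/
theorem exists_mem_topIdeal_sub {e₀ e₁ e₂ e₃ : C} {s : C} (hs : s ∈ topIdeal a b c d) :
    ∃ s' ∈ topIdeal (a - p ^ n * e₀) (b - p ^ n * e₁) (c - p ^ n * e₂) (d - p ^ n * e₃),
      ∃ r, s = s' + p ^ n * r := by
  obtain ⟨u, v, w, rfl⟩ := mem_topIdeal.mp hs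
  refine ⟨_, mem_topIdeal.mpr ⟨u, v, w, rfl⟩, u * (a * e₂ + e₀ * c - p ^ n * e₀ * e₂)
    + v * (a * e₃ + e₀ * d - p ^ n * e₀ * e₃) + w * (b * e₃ + e₁ * d - p ^ n * e₁ * e₃), by ring⟩

variable {k : Type*} [CommRing k] {π : C →+* LocalAlgebra k}

theorem exists_mem_topIdeal (hπ : Function.Surjective π)
    (hker : ∀ x, π x = 0 → ∃ y, x = p * y) (ha : π a = gen k 0) (hb : π b = gen k 1)
    (hc : π c = gen k 2) (hd : π d = gen k 3) {x : C}
    (hx : π x ∈ topIdeal (gen k 0) (gen k 1) (gen k 2) (gen k 3)) :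
    ∃ s ∈ topIdeal a b c d, ∃ z, x = s + p * z := by
  obtain ⟨u, v, w, h⟩ := mem_topIdeal.mp hx
  obtain ⟨u, rfl⟩ := hπ u
  obtain ⟨v, rfl⟩ := hπ v
  obtain ⟨w, rfl⟩ := hπ w
  obtain ⟨z, hz⟩ := hker (x - (u * (a * c) + v * (a * d) + w * (b * d))) (by simp [*])
  exact ⟨_, mem_topIdeal.mpr ⟨u, v, w, rfl⟩, z, by linear_combination hz⟩

/-- Solutions of the quadrics up to order `n` lift to solutions up to order `n + 1`. -/
theorem QuadricsVanish.exists_succ (hn : 1 ≤ n) (hp : ∀ x, p * x = 0 → x = 0)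
    (hπ : Function.Surjective π) (hπp : π p = 0) (hker : ∀ x, π x = 0 → ∃ y, x = p * y)
    (ha : π a = gen k 0) (hb : π b = gen k 1) (hc : π c = gen k 2) (hd : π d = gen k 3)
    (h : QuadricsVanish p n a b c d) :
    ∃ a' b' c' d', π a' = gen k 0 ∧ π b' = gen k 1 ∧ π c' = gen k 2 ∧ π d' = gen k 3 ∧
      QuadricsVanish p (n + 1) a' b' c' d' := by
  have hpn (j : ℕ) {x : C} (hx : p ^ j * x = 0) : x = 0 := by
    induction j with
    | zero => simpa using hx
    | succ j ih => exact ih (hp _ (by rw [← mul_assoc, ← pow_succ', hx]))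
  have mem_a : a ∈ Ideal.span {a, b, c, d} := Ideal.subset_span (by simp)
  have mem_b : b ∈ Ideal.span {a, b, c, d} := Ideal.subset_span (by simp)
  have mem_c : c ∈ Ideal.span {a, b, c, d} := Ideal.subset_span (by simp)
  have mem_d : d ∈ Ideal.span {a, b, c, d} := Ideal.subset_span (by simp)
  obtain ⟨s₁, hs₁, r₁, hr₁⟩ := mem_errorIdeal.mp h.sq_a
  obtain ⟨s₂, hs₂, r₂, hr₂⟩ := mem_errorIdeal.mp h.ab
  obtain ⟨s₃, hs₃, r₃, hr₃⟩ := mem_errorIdeal.mp h.sq_b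
  obtain ⟨s₄, hs₄, r₄, hr₄⟩ := mem_errorIdeal.mp h.sq_c
  obtain ⟨s₅, hs₅, r₅, hr₅⟩ := mem_errorIdeal.mp h.cd
  obtain ⟨s₆, hs₆, r₆, hr₆⟩ := mem_errorIdeal.mp h.sq_d
  obtain ⟨s₇, hs₇, r₇, hr₇⟩ := mem_errorIdeal.mp h.det
  -- The right side lies in `p · mJ ⊆ (pⁿ⁺¹)`; cancelling `pⁿ` leaves `x ∈ pC`.
  have syz {x s : C} (hs : s ∈ Ideal.span {a, b, c, d} * topIdeal a b c d)
      (hx : p ^ n * x = p * s) : π x = 0 := by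
    obtain ⟨y, rfl⟩ := Ideal.mem_span_singleton'.mp (h.mul_topIdeal_le hs)
    rw [sub_eq_zero.mp (hpn n (x := x - p * y) (by linear_combination hx)), map_mul, hπp, zero_mul]
  have syz₂ {x₁ x₂ y₁ y₂ t₁ t₂ : C} (h₁ : x₁ ∈ Ideal.span {a, b, c, d})
      (h₂ : x₂ ∈ Ideal.span {a, b, c, d}) (ht₁ : t₁ ∈ topIdeal a b c d)
      (ht₂ : t₂ ∈ topIdeal a b c d)
      (e : x₁ * (p * t₁ + p ^ n * y₁) = x₂ * (p * t₂ + p ^ n * y₂)) :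
      π x₁ * π y₁ = π x₂ * π y₂ := by
    have := syz (x := x₁ * y₁ - x₂ * y₂)
      (sub_mem (Ideal.mul_mem_mul h₂ ht₂) (Ideal.mul_mem_mul h₁ ht₁)) (by linear_combination e)
    rwa [map_sub, map_mul, map_mul, sub_eq_zero] at this
  have syz₃ {x₁ x₂ x₃ y₁ y₂ y₃ t₁ t₂ t₃ : C} (h₁ : x₁ ∈ Ideal.span {a, b, c, d})
      (h₂ : x₂ ∈ Ideal.span {a, b, c, d}) (h₃ : x₃ ∈ Ideal.span {a, b, c, d})
      (ht₁ : t₁ ∈ topIdeal a b c d) (ht₂ : t₂ ∈ topIdeal a b c d) (ht₃ : t₃ ∈ topIdeal a b c d)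
      (e : x₁ * (p * t₁ + p ^ n * y₁) =
        x₂ * (p * t₂ + p ^ n * y₂) - x₃ * (p * t₃ + p ^ n * y₃)) :
      π x₁ * π y₁ = π x₂ * π y₂ - π x₃ * π y₃ := by
    have := syz (x := x₁ * y₁ - (x₂ * y₂ - x₃ * y₃))
      (sub_mem (sub_mem (Ideal.mul_mem_mul h₂ ht₂) (Ideal.mul_mem_mul h₃ ht₃))
        (Ideal.mul_mem_mul h₁ ht₁)) (by linear_combination e)
    rwa [map_sub, map_sub, map_mul, map_mul, map_mul, sub_eq_zero] at this
  -- The eight linear syzygies, such as `b · a² = a · ab`, pass to the remainders `rᵢ` modulo `p`.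
  have k₁ := syz₂ (y₁ := r₁) (y₂ := r₂) mem_b mem_a hs₁ hs₂ (by rw [← hr₁, ← hr₂]; ring)
  have k₂ := syz₂ (y₁ := r₃) (y₂ := r₂) mem_a mem_b hs₃ hs₂ (by rw [← hr₃, ← hr₂]; ring)
  have k₃ := syz₃ (y₁ := r₇) (y₂ := r₁) (y₃ := r₂) mem_a mem_d mem_c hs₇ hs₁ hs₂
    (by rw [← hr₇, ← hr₁, ← hr₂]; ring)
  have k₄ := syz₃ (y₁ := r₇) (y₂ := r₂) (y₃ := r₃) mem_b mem_d mem_c hs₇ hs₂ hs₃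
    (by rw [← hr₇, ← hr₂, ← hr₃]; ring)
  have k₅ := syz₂ (y₁ := r₄) (y₂ := r₅) mem_d mem_c hs₄ hs₅ (by rw [← hr₄, ← hr₅]; ring)
  have k₆ := syz₂ (y₁ := r₆) (y₂ := r₅) mem_c mem_d hs₆ hs₅ (by rw [← hr₆, ← hr₅]; ring)
  have k₇ := syz₃ (y₁ := r₇) (y₂ := r₅) (y₃ := r₄) mem_c mem_a mem_b hs₇ hs₅ hs₄
    (by rw [← hr₇, ← hr₅, ← hr₄]; ring)
  have k₈ := syz₃ (y₁ := r₇) (y₂ := r₆) (y₃ := r₅) mem_d mem_a mem_b hs₇ hs₆ hs₅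
    (by rw [← hr₇, ← hr₆, ← hr₅]; ring)
  rw [ha, hb] at k₁ k₂
  rw [ha, hc, hd] at k₃
  rw [hb, hc, hd] at k₄
  rw [hc, hd] at k₅ k₆
  rw [ha, hb, hc] at k₇
  rw [ha, hb, hd] at k₈
  obtain ⟨e₀, e₁, e₂, e₃, t₁, t₂, t₃, t₄, t₅, t₆, t₇⟩ :=
    exists_translation k₁ k₂ k₃ k₄ k₅ k₆ k₇ k₈
  obtain ⟨e₀, rfl⟩ := hπ e₀
  obtain ⟨e₁, rfl⟩ := hπ e₁
  obtain ⟨e₂, rfl⟩ := hπ e₂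
  obtain ⟨e₃, rfl⟩ := hπ e₃
  have hπ2 : π 2 = 2 := map_ofNat π 2
  have hπpn (x : C) : π (p ^ n * x) = 0 := by
    rw [map_mul, map_pow, hπp, zero_pow (by omega), zero_mul]
  -- Since `n ≥ 1`, a term `pⁿs'` with `s' ∈ J` equals `p · pˡs'` and is absorbed in `pJ`.
  obtain ⟨l, rfl⟩ : ∃ l, n = l + 1 := ⟨n - 1, by omega⟩
  -- Expansion of a quadric after translation: `δ` is the linear change and `y` the quadratic one,
  -- whose factor `p²ⁿ` is divisible by `pⁿ⁺¹`.
  have fin {q r s : C} (δ y : C) (hs : s ∈ topIdeal a b c d) (hq : q = p * s + p ^ (l + 1) * r)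
      (hr : π (r - δ) ∈ topIdeal (gen k 0) (gen k 1) (gen k 2) (gen k 3)) :
      q - p ^ (l + 1) * δ + p ^ (l + 1) * p ^ (l + 1) * y ∈ errorIdeal p (l + 1 + 1)
        (a - p ^ (l + 1) * e₀) (b - p ^ (l + 1) * e₁) (c - p ^ (l + 1) * e₂)
        (d - p ^ (l + 1) * e₃) := by
    obtain ⟨s', hs', z, hz⟩ := exists_mem_topIdeal hπ hker ha hb hc hd hr
    obtain ⟨s'', hs'', z', hz'⟩ := exists_mem_topIdeal_sub (p := p) (n := l + 1) (e₀ := e₀) (e₁ := e₁)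
      (e₂ := e₂) (e₃ := e₃) (add_mem hs (Ideal.mul_mem_left _ (p ^ l) hs'))
    refine mem_errorIdeal.mpr ⟨s'', hs'', z + z' + p ^ l * y, ?_⟩
    rw [hq]
    linear_combination p ^ (l + 1) * hz + p * hz'
  refine ⟨a - p ^ (l + 1) * e₀, b - p ^ (l + 1) * e₁, c - p ^ (l + 1) * e₂, d - p ^ (l + 1) * e₃,
    by rw [map_sub, hπpn, sub_zero, ha], by rw [map_sub, hπpn, sub_zero, hb],
    by rw [map_sub, hπpn, sub_zero, hc], by rw [map_sub, hπpn, sub_zero, hd], ?_⟩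
  constructor
  · convert fin (2 * e₀ * a) (e₀ ^ 2) hs₁ hr₁ (by simpa [hπ2, ha] using t₁) using 1; ring
  · convert fin (e₀ * b + e₁ * a) (e₀ * e₁) hs₂ hr₂ (by simpa [ha, hb] using t₂) using 1; ring
  · convert fin (2 * e₁ * b) (e₁ ^ 2) hs₃ hr₃ (by simpa [hπ2, hb] using t₃) using 1; ring
  · convert fin (2 * e₂ * c) (e₂ ^ 2) hs₄ hr₄ (by simpa [hπ2, hc] using t₄) using 1; ring
  · convert fin (e₂ * d + e₃ * c) (e₂ * e₃) hs₅ hr₅ (by simpa [hc, hd] using t₅) using 1; ring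
  · convert fin (2 * e₃ * d) (e₃ ^ 2) hs₆ hr₆ (by simpa [hπ2, hd] using t₆) using 1; ring
  · convert fin (e₀ * d + e₃ * a - e₁ * c - e₂ * b) (e₀ * e₃ - e₁ * e₂) hs₇ hr₇
      (by simpa [ha, hb, hc, hd] using t₇) using 1
    ring

/-- A `p`-torsion-free ring with reduction modulo `p` the local algebra contains elements that lift
`a` and whose cube is divisible by an arbitrary power of `p`. -/
theorem exists_lift_cube_eq (hp : ∀ x, p * x = 0 → x = 0)
    (hπ : Function.Surjective π) (hπp : π p = 0) (hker : ∀ x, π x = 0 → ∃ y, x = p * y) (n : ℕ) :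
    ∃ x, π x = gen k 0 ∧ ∃ y, x ^ 3 = p ^ n * y := by
  have key (n : ℕ) : ∃ a b c d, π a = gen k 0 ∧ π b = gen k 1 ∧ π c = gen k 2 ∧ π d = gen k 3 ∧
      QuadricsVanish p (n + 1) a b c d := by
    induction n with
    | zero =>
      obtain ⟨a, ha⟩ := hπ (gen k 0)
      obtain ⟨b, hb⟩ := hπ (gen k 1)
      obtain ⟨c, hc⟩ := hπ (gen k 2)
      obtain ⟨d, hd⟩ := hπ (gen k 3)
      -- At order one the error ideal contains all of `pC`, so arbitrary lifts work.
      have key {q : C} (hq : π q = 0) : q ∈ errorIdeal p (0 + 1) a b c d := by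
        obtain ⟨y, rfl⟩ := hker q hq
        exact mem_errorIdeal.mpr ⟨0, zero_mem _, y, by ring⟩
      refine ⟨a, b, c, d, ha, hb, hc, hd, key ?_, key ?_, key ?_, key ?_, key ?_, key ?_, key ?_⟩
      · rw [map_pow, ha, gen_zero_sq]
      · rw [map_mul, ha, hb, gen_zero_mul_gen_one]
      · rw [map_pow, hb, gen_one_sq]
      · rw [map_pow, hc, gen_two_sq]
      · rw [map_mul, hc, hd, gen_two_mul_gen_three]
      · rw [map_pow, hd, gen_three_sq]
      · rw [map_sub, map_mul, map_mul, ha, hb, hc, hd, gen_det]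
    | succ n ih =>
      obtain ⟨a, b, c, d, ha, hb, hc, hd, h⟩ := ih
      exact h.exists_succ (by omega) hp hπ hπp hker ha hb hc hd
  obtain ⟨a, b, c, d, ha, -, -, -, h⟩ := key n
  obtain ⟨y, hy⟩ := h.exists_cube_eq
  exact ⟨a, ha, p * y, by rw [hy]; ring⟩

end Lifting

/-! ### Orders in étale algebras and divisibility by `p` -/

section Order

/-- The integral closure embeds in the product of the rings of integers of the number fields, and
`ℤ` is noetherian. -/
theorem finite_integralClosure_of_etale (K : Type u) [CommRing K] [Algebra ℚ K]
    [Algebra.Etale ℚ K] : Module.Finite ℤ (integralClosure ℤ K) := by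
  obtain ⟨I, _, L, _, _, e, hL⟩ :=
    (Algebra.Etale.iff_exists_algEquiv_prod (K := ℚ) (A := K)).mp inferInstance
  have hfin (i : I) : Module.Finite ℤ (integralClosure ℤ (L i)) := by
    obtain ⟨_, _⟩ := hL i
    exact IsIntegralClosure.finite ℤ ℚ (L i) (integralClosure ℤ (L i))
  let f (i : I) : K →ₐ[ℤ] L i := ((Pi.evalAlgHom ℚ L i).comp e.toAlgHom).restrictScalars ℤ
  let φ : integralClosure ℤ K →ₗ[ℤ] Π i, integralClosure ℤ (L i) :=
    LinearMap.pi fun i => ((integralClosure ℤ (L i)).val.toLinearMap.codRestrict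
      (Subalgebra.toSubmodule (integralClosure ℤ (L i))) fun x => x.2) ∘ₗ
      ((f i).toLinearMap.comp (integralClosure ℤ K).val.toLinearMap).codRestrict
      (Subalgebra.toSubmodule (integralClosure ℤ (L i))) fun x => x.2.map (f i)
  have hφ : Function.Injective φ := by
    intro x y hxy
    apply Subtype.ext
    apply e.injective
    funext i
    exact congrArg Subtype.val (congrFun hxy i)
  exact Module.Finite.of_injective φ hφ

variable {K : Type u} [CommRing K] [Algebra ℚ K] {A : Subring K}

theorem _root_.IsOrderIn.exists_natCast_mul_mem (hA : IsOrderIn K A) (x : K) :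
    ∃ D : ℕ, D ≠ 0 ∧ (D : K) * x ∈ A := by
  have hx : x ∈ Submodule.span ℚ (A : Set K) := hA.span_eq_top ▸ Submodule.mem_top
  induction hx using Submodule.span_induction with
  | mem x hx => exact ⟨1, one_ne_zero, by simpa using hx⟩
  | zero => exact ⟨1, one_ne_zero, by simp [A.zero_mem]⟩
  | add x y _ _ hx hy =>
    obtain ⟨D, hD, hDx⟩ := hx
    obtain ⟨E, hE, hEy⟩ := hy
    refine ⟨D * E, mul_ne_zero hD hE, ?_⟩
    convert A.add_mem (A.mul_mem (natCast_mem A E) hDx) (A.mul_mem (natCast_mem A D) hEy) using 1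
    push_cast
    ring
  | smul q x _ hx =>
    obtain ⟨D, hD, hDx⟩ := hx
    refine ⟨D * q.den, mul_ne_zero hD q.den_ne_zero, ?_⟩
    convert A.mul_mem (intCast_mem A q.num) hDx using 1
    have hq : (q.den : K) * algebraMap ℚ K q = (q.num : K) := by
      rw [← map_natCast (algebraMap ℚ K), ← map_mul, mul_comm, Rat.mul_den_eq_num, map_intCast]
    rw [Algebra.smul_def, ← hq]
    push_cast
    ring

/-- Multiply the denominators of finitely many generators of the integral closure. -/
theorem _root_.IsOrderIn.exists_forall_natCast_mul_mem [Algebra.Etale ℚ K] (hA : IsOrderIn K A) :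
    ∃ D : ℕ, D ≠ 0 ∧ ∀ x : K, IsIntegral ℤ x → (D : K) * x ∈ A := by
  obtain ⟨S, hS⟩ := (finite_integralClosure_of_etale K).fg_top
  choose D hD hDmem using hA.exists_natCast_mul_mem
  refine ⟨∏ s ∈ S, D s, Finset.prod_ne_zero_iff.mpr fun s _ => hD s, fun x hx => ?_⟩
  have hmem : (⟨x, hx⟩ : integralClosure ℤ K) ∈ Submodule.span ℤ (S : Set (integralClosure ℤ K)) :=
    hS ▸ Submodule.mem_top
  suffices ∀ y : integralClosure ℤ K, y ∈ Submodule.span ℤ (S : Set (integralClosure ℤ K)) →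
      ((∏ s ∈ S, D s : ℕ) : K) * y ∈ A from this _ hmem
  intro y hy
  induction hy using Submodule.span_induction with
  | mem y hy =>
    obtain ⟨r, hr⟩ := Finset.dvd_prod_of_mem (fun s : integralClosure ℤ K => D s) hy
    rw [hr]
    convert A.mul_mem (natCast_mem A r) (hDmem y) using 1
    push_cast
    ring
  | zero => simp [A.zero_mem]
  | add y z _ _ hy hz => simpa [mul_add] using A.add_mem hy hz
  | smul n y _ hy =>
    convert A.mul_mem (intCast_mem A n) hy using 1
    simp
    ring

theorem isUnit_natCast {n : ℕ} (hn : n ≠ 0) : IsUnit (n : K) := by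
  rw [← map_natCast (algebraMap ℚ K)]
  exact (isUnit_iff_ne_zero.mpr (Nat.cast_ne_zero.mpr hn)).map _

/-- In an order of an étale algebra, an element whose cube is divisible by a large power of `p` is
divisible by `p`. -/
theorem _root_.IsOrderIn.exists_dvd_of_cube_eq [Algebra.Etale ℚ K] (hA : IsOrderIn K A) {p : ℕ}
    (hp : p.Prime) : ∃ N : ℕ, ∀ x y : A, x ^ 3 = (p : A) ^ N * y → ∃ z : A, x = p * z := by
  obtain ⟨D, hD, hDmem⟩ := hA.exists_forall_natCast_mul_mem
  obtain ⟨j, u, hpu, rfl⟩ := Nat.exists_eq_pow_mul_and_not_dvd hD p hp.ne_one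
  -- With `D = pʲu`, the quotient `w = x / pʲ⁺¹` has cube `y`, so it is integral and `Dw ∈ A`. The
  -- extra factor `p` gives `ux ∈ pA`, and `u` is prime to `p`.
  refine ⟨3 * (j + 1), fun x y hxy => ?_⟩
  have := hA.finite
  have hunit : IsUnit ((p : K) ^ (j + 1)) := (isUnit_natCast hp.ne_zero).pow _
  obtain ⟨w, hw⟩ : ∃ w : K, (p : K) ^ (j + 1) * w = x :=
    ⟨↑hunit.unit⁻¹ * x, by rw [← mul_assoc, hunit.mul_val_inv, one_mul]⟩
  have hwy : w ^ 3 = y := by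
    have h := congrArg Subtype.val hxy
    push_cast at h
    refine (hunit.pow 3).mul_left_cancel ?_
    rw [← mul_pow, hw, h]
    ring
  have hy : IsIntegral ℤ (y : K) :=
    (Algebra.IsIntegral.isIntegral (R := ℤ) y).map A.subtype.toIntAlgHom
  have hwint : IsIntegral ℤ w := IsIntegral.of_pow (n := 3) (by norm_num) (hwy ▸ hy)
  obtain ⟨z, hz⟩ : ∃ z : A, (z : K) = ((p ^ j * u : ℕ) : K) * w := ⟨⟨_, hDmem w hwint⟩, rfl⟩
  have hux : (u : A) * x = p * z := by
    apply Subtype.ext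
    push_cast
    rw [hz, ← hw]
    push_cast
    ring
  obtain ⟨α, β, hαβ⟩ := Int.isCoprime_iff_gcd_eq_one.mpr
    (show Int.gcd (u : ℤ) (p : ℤ) = 1 from ((Nat.Prime.coprime_iff_not_dvd hp).mpr hpu).symm)
  have hαβ' : (α : A) * u + β * p = 1 := by exact_mod_cast congrArg (Int.cast : ℤ → A) hαβ
  exact ⟨α * z + β * x, by linear_combination (-x) * hαβ' + α * hux⟩

theorem eq_zero_of_natCast_mul_eq_zero {n : ℕ} (hn : n ≠ 0) {x : A} (h : (n : A) * x = 0) :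
    x = 0 := by
  apply Subtype.ext
  refine (isUnit_natCast (K := K) hn).mul_left_cancel ?_
  simpa using congrArg Subtype.val h

end Order

/-! ### Isolating the local factor and the contradiction -/

theorem not_isModPOfEtaleOrder_rankEightTimesSplit {p : ℕ} (hp : p.Prime) (m : ℕ) :
    ¬ IsModPOfEtaleOrder.{u, 0} p (RankEightTimesSplit (ZMod p) m) := by
  rintro ⟨K, _, _, A, _, hA, ⟨e⟩⟩
  have : Fact p.Prime := ⟨hp⟩
  obtain ⟨N, hN⟩ := hA.exists_dvd_of_cube_eq hp
  let q : A →+* RankEightTimesSplit (ZMod p) m :=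
    (e.symm : _ →+* RankEightTimesSplit (ZMod p) m).comp (Ideal.Quotient.mk (Ideal.span {(p : A)}))
  have hq : Function.Surjective q := e.symm.surjective.comp Ideal.Quotient.mk_surjective
  have hqp : q p = 0 := by
    have h0 : Ideal.Quotient.mk (Ideal.span {(p : A)}) p = 0 :=
      Ideal.Quotient.eq_zero_iff_mem.mpr (Ideal.mem_span_singleton_self _)
    simp only [q, RingHom.comp_apply, h0, map_zero]
  have hqker {x : A} (hx : q x = 0) : ∃ y, x = p * y := by
    have h0 : Ideal.Quotient.mk (Ideal.span {(p : A)}) x = 0 :=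
      e.symm.injective (by simpa [q] using hx)
    obtain ⟨y, hy⟩ := Ideal.mem_span_singleton'.mp (Ideal.Quotient.eq_zero_iff_mem.mp h0)
    exact ⟨y, by rw [← hy, mul_comm]⟩
  let ρ : A →+* LocalAlgebra (ZMod p) := (RingHom.fst _ _).comp q
  have hρ : Function.Surjective ρ := Prod.fst_surjective.comp hq
  have hρp : ρ p = 0 := by simp only [ρ, RingHom.comp_apply, hqp, map_zero]
  obtain ⟨ε, hε⟩ := hq (1, 0)
  have hρε : ρ ε = 1 := by simp only [ρ, RingHom.comp_apply, hε]; rfl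
  have hρker {x : A} (hx : ρ x = 0) : ∃ y, ε * x = p * y := by
    refine hqker ?_
    rw [map_mul, hε]
    refine Prod.ext ?_ ?_
    · change 1 * ρ x = 0
      rw [hx, mul_zero]
    · exact zero_mul _
  -- As `ε` reduces to `(1, 0)`, inverting it kills the split factors modulo `p` and leaves the
  -- local algebra.
  let C := Localization.Away ε
  let π : C →+* LocalAlgebra (ZMod p) := Localization.awayLift ρ ε (by rw [hρε]; exact isUnit_one)
  have hπ (x : A) : π (algebraMap A C x) = ρ x := IsLocalization.Away.lift_eq _ _ _
  have hunit (n : ℕ) : IsUnit (algebraMap A C ε ^ n) :=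
    (IsLocalization.Away.algebraMap_isUnit ε).pow n
  have hcancel {x : A} (hx : algebraMap A C x = 0) : ∃ n : ℕ, ε ^ n * x = 0 := by
    obtain ⟨⟨_, n, rfl⟩, hc⟩ := (IsLocalization.map_eq_zero_iff (Submonoid.powers ε) C x).mp hx
    exact ⟨n, hc⟩
  obtain ⟨x, hx, y, hxy⟩ := exists_lift_cube_eq (p := (p : C)) (π := π)
    (fun x hx => by
      obtain ⟨n, a, ha⟩ := IsLocalization.Away.surj ε x
      obtain ⟨j, hj⟩ := hcancel (x := p * a) (by
        rw [map_mul, map_natCast, ← ha, ← mul_assoc, hx, zero_mul])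
      have h0 : ε ^ j * a = 0 := eq_zero_of_natCast_mul_eq_zero hp.ne_zero (n := p)
        (by rw [← hj]; ring)
      refine ((hunit n).mul (hunit j)).mul_left_eq_zero.mp ?_
      rw [← mul_assoc, ha, ← map_pow, ← map_mul, mul_comm, h0, map_zero])
    (fun s => by
      obtain ⟨a, rfl⟩ := hρ s
      exact ⟨algebraMap A C a, hπ a⟩)
    (by rw [← map_natCast (algebraMap A C), hπ, hρp])
    (fun x hx => by
      obtain ⟨n, a, ha⟩ := IsLocalization.Away.surj ε x
      obtain ⟨y, hy⟩ := hρker (x := a) (by rw [← hπ, ← ha, map_mul, hx, zero_mul])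
      obtain ⟨v, hv⟩ := (hunit (n + 1)).exists_right_inv
      have hy' := congrArg (algebraMap A C) hy
      rw [map_mul, map_mul, map_natCast] at hy'
      exact ⟨algebraMap A C y * v, by
        linear_combination (-x) * hv + algebraMap A C ε * v * ha + v * hy'⟩) N
  obtain ⟨n, a, ha⟩ := IsLocalization.Away.surj ε x
  obtain ⟨l, b, hb⟩ := IsLocalization.Away.surj ε y
  obtain ⟨j, hj⟩ := hcancel (x := a ^ 3 * ε ^ l - p ^ N * b * ε ^ (3 * n)) (by
    simp only [map_sub, map_mul, map_pow, map_natCast, ← ha, ← hb]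
    linear_combination algebraMap A C ε ^ (3 * n) * algebraMap A C ε ^ l * hxy)
  -- Clearing denominators leaves powers of `ε`; multiplying by `ε^(2j+2l)` turns the left side into
  -- the cube of `ε^(j+l) a`. These powers are harmless because `ρ ε = 1`.
  obtain ⟨z, hz⟩ := hN (ε ^ (j + l) * a) (ε ^ (3 * j + 2 * l) * b * ε ^ (3 * n)) (by
    linear_combination ε ^ (2 * j + 2 * l) * hj)
  have h0 : ρ a = 0 := by
    have := congrArg ρ hz
    rwa [map_mul, map_mul, map_pow, hρε, one_pow, one_mul, hρp, zero_mul] at this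
  have h1 : ρ a = gen (ZMod p) 0 := by
    rw [← hπ, ← ha, map_mul, map_pow, hπ, hρε, one_pow, mul_one, hx]
  exact gen_zero_ne_zero (h1.symm.trans h0)

end RankEight

theorem mainTheorem12 (n : ℕ) (hn : 8 ≤ n) :
    (∃ p : ℕ, p.Prime ∧ ∃ (R : Type) (_ : CommRing R) (_ : Algebra (ZMod p) R),
      Module.finrank (ZMod p) R = n ∧ ¬ IsModPOfEtaleOrder.{u, 0} p R) ∧
    (∀ p : ℕ, p.Prime →
      Module.finrank (ZMod p) (RankEightTimesSplit (ZMod p) (n - 8)) = n ∧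
      ¬ IsModPOfEtaleOrder.{u, 0} p (RankEightTimesSplit (ZMod p) (n - 8))) := by
  have key (p : ℕ) (hp : p.Prime) :
      Module.finrank (ZMod p) (RankEightTimesSplit (ZMod p) (n - 8)) = n ∧
      ¬ IsModPOfEtaleOrder.{u, 0} p (RankEightTimesSplit (ZMod p) (n - 8)) := by
    have : Fact p.Prime := ⟨hp⟩
    refine ⟨?_, RankEight.not_isModPOfEtaleOrder_rankEightTimesSplit hp _⟩
    rw [RankEight.finrank_rankEightTimesSplit]
    omega
  exact ⟨⟨2, Nat.prime_two, _, _, _, key 2 Nat.prime_two⟩, key⟩
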